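/- Let $d\ge 1$, let $\mathbb{S}^d$ be the unit sphere of $\mathbb{R}^{d+1}$ with north pole $N$ and surface measure $\sigma$, and let $L^p(\mathbb{S}^d)$ be the space of complex-valued $L^p$ functions with respect to $\sigma$. Let $\mathcal{H}_\ell$ be the space of spherical harmonics of degree $\ell$ (restrictions to $\mathbb{S}^d$ of homogeneous harmonic polynomials of degree $\ell$ on $\mathbb{R}^{d+1}$, with complex coefficients), $\Pi_L=\operatorname{span}\bigcup_{\ell=0}^{L}\mathcal{H}_\ell$ and $\mathcal{P}(\mathbb{S}^d)=\operatorname{span}\bigcup_{\ell\ge 0}\mathcal{H}_\ell$. A function $g$ on $\mathbb{S}^d$ is called zonal if $g(\omega)$ depends only on $\langle\omega,N\rangle$ (so $g$ is invariant under all $\rho\in SO(d+1)$ with $\rho N=N$); then $g^\flat$ denotes the function on $[-1,1]$ with $g^\flat(\langle\omega,N\rangle)=g(\omega)$. For $f,g\in L^1(\mathbb{S}^d)$ with $g$ zonal put $$(g*f)(\omega)=\int_{\mathbb{S}^d}g^\flat(\langle\omega,x\rangle)f(x)\,d\sigma(x).$$ A zonal multiplier is a linear map from $\mathcal{P}(\mathbb{S}^d)$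 to $\mathcal{C}(\mathbb{S}^d)$ that commutes with the rotations in $SO(d+1)$. Then there is a constant $C<\infty$, depending only on $d$, such that for every integer $L\ge 0$ there is a zonal function $g\in L^1(\mathbb{S}^d)$ for which the convolution operator $Tf=g*f$ has the following properties. On $\mathcal{P}(\mathbb{S}^d)$ the integral converges at every point and $T$ is a zonal multiplier. For every $1\le p\le\infty$ and $f\in L^p(\mathbb{S}^d)$ the integral converges at almost every point, and $T$ is a bounded linear operator on $L^p(\mathbb{S}^d)$ such that 1. $\|T\|_{L^p\to L^p}\le C$; 2. $Tf\in\Pi_{3L}$ for every $f\in L^p(\mathbb{S}^d)$; 3. $Tf=f$ for every $f\in\Pi_L$. -/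

import Mathlib

open MeasureTheory
open scoped ENNReal

noncomputable section

namespace SphereMultiplier

/-- The unit sphere `𝕊^d` of `ℝ^{d+1}`. -/
abbrev Sphere (d : ℕ) : Type :=
  Metric.sphere (0 : EuclideanSpace ℝ (Fin (d + 1))) 1

/-- Lebesgue surface measure on `𝕊^d`. -/
def surfaceMeasure (d : ℕ) : Measure (Sphere d) :=
  (volume : Measure (EuclideanSpace ℝ (Fin (d + 1)))).toSphere

instance (d : ℕ) : IsFiniteMeasure (surfaceMeasure d) := by
  unfold surfaceMeasure
  infer_instance

/-- The north pole `N = (0, …, 0, 1)`. -/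
def northPole (d : ℕ) : Sphere d :=
  ⟨EuclideanSpace.single (Fin.last d) 1, by simp⟩

/-- The scalar product of `ℝ^{d+1}` for two points of the sphere. -/
def sphereInner {d : ℕ} (u v : Sphere d) : ℝ :=
  inner ℝ (u : EuclideanSpace ℝ (Fin (d + 1))) (v : EuclideanSpace ℝ (Fin (d + 1)))

/-- The Laplacian on polynomials in `d + 1` variables. -/
def polyLaplacian (d : ℕ) :
    MvPolynomial (Fin (d + 1)) ℂ →ₗ[ℂ] MvPolynomial (Fin (d + 1)) ℂ :=
  ∑ i, (MvPolynomial.pderiv i).toLinearMap ∘ₗ (MvPolynomial.pderiv i).toLinearMap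

/-- Restriction of a polynomial on `ℝ^{d+1}` to the sphere. -/
def restrictToSphere (d : ℕ) :
    MvPolynomial (Fin (d + 1)) ℂ →ₗ[ℂ] C(Sphere d, ℂ) where
  toFun P :=
    { toFun := fun ω =>
        MvPolynomial.eval
          (fun i => (((ω : EuclideanSpace ℝ (Fin (d + 1))) i : ℝ) : ℂ)) P
      continuous_toFun := by
        refine (MvPolynomial.continuous_eval P).comp ?_
        fun_prop }
  map_add' P Q := by ext ω; simp
  map_smul' c P := by ext ω; simp [MvPolynomial.smul_eval]

/-- Spherical harmonics of degree `ℓ`: restrictions to the sphere of the homogeneous harmonic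
polynomials of degree `ℓ`. -/
def harmonicSpace (d ℓ : ℕ) : Submodule ℂ C(Sphere d, ℂ) :=
  (MvPolynomial.homogeneousSubmodule (Fin (d + 1)) ℂ ℓ ⊓
    LinearMap.ker (polyLaplacian d)).map (restrictToSphere d)

/-- `Π_L`: the span of the spherical harmonics of degree at most `L`. -/
def harmonicsUpTo (d L : ℕ) : Submodule ℂ C(Sphere d, ℂ) :=
  ⨆ ℓ ∈ Finset.range (L + 1), harmonicSpace d ℓ

/-- `𝒫(𝕊^d)`: the span of all spherical harmonics. -/
def spherePolynomials (d : ℕ) : Submodule ℂ C(Sphere d, ℂ) :=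
  ⨆ ℓ : ℕ, harmonicSpace d ℓ

/-- `SO(d+1)`: linear isometries of `ℝ^{d+1}` of determinant one. -/
def IsRotation {d : ℕ}
    (ρ : EuclideanSpace ℝ (Fin (d + 1)) ≃ₗᵢ[ℝ] EuclideanSpace ℝ (Fin (d + 1))) : Prop :=
  LinearMap.det (ρ.toLinearEquiv.toLinearMap) = 1

/-- The action of a linear isometry on the sphere. -/
def actOnSphere {d : ℕ}
    (ρ : EuclideanSpace ℝ (Fin (d + 1)) ≃ₗᵢ[ℝ] EuclideanSpace ℝ (Fin (d + 1)))
    (ω : Sphere d) : Sphere d :=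
  ⟨ρ ω, by simp⟩

/-- A zonal multiplier: a linear map `𝒫(𝕊^d) → 𝒞(𝕊^d)` commuting with rotations
(here `h` is the rotated function `f ∘ ρ`). -/
def IsZonalMultiplier {d : ℕ} (M : spherePolynomials d →ₗ[ℂ] C(Sphere d, ℂ)) : Prop :=
  ∀ ρ : EuclideanSpace ℝ (Fin (d + 1)) ≃ₗᵢ[ℝ] EuclideanSpace ℝ (Fin (d + 1)),
    IsRotation ρ → ∀ f h : spherePolynomials d,
      (∀ ω, (h : C(Sphere d, ℂ)) ω = (f : C(Sphere d, ℂ)) (actOnSphere ρ ω)) →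
      ∀ ω, M h ω = M f (actOnSphere ρ ω)

/-- A zonal function: invariant under the rotations that fix the north pole. -/
def IsZonal {d : ℕ} (g : Sphere d → ℂ) : Prop :=
  ∀ ρ : EuclideanSpace ℝ (Fin (d + 1)) ≃ₗᵢ[ℝ] EuclideanSpace ℝ (Fin (d + 1)),
    IsRotation ρ → actOnSphere ρ (northPole d) = northPole d →
      ∀ ω, g (actOnSphere ρ ω) = g ω

/-- The profile `g♭` of a function `g` that depends only on `⟨ω, N⟩`:
`g♭(⟨ω, N⟩) = g(ω)`, and `g♭ = 0` outside `[-1, 1]`. -/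
def profile {d : ℕ} (g : Sphere d → ℂ) : ℝ → ℂ :=
  Function.extend (fun ω : Sphere d => sphereInner ω (northPole d)) g 0

/-- The profile satisfies its defining equation, i.e. `g(ω)` depends only on `⟨ω, N⟩`. For
`d ≥ 2` this is equivalent to `g` being zonal; for `d = 1`, where only the identity rotation fixes
the north pole, it is the meaning of zonality that the convolution needs. -/
def HasProfile {d : ℕ} (g : Sphere d → ℂ) : Prop :=
  ∀ ω, profile g (sphereInner ω (northPole d)) = g ω

/-- The integrand of the convolution `g ∗ f` at `ω`. -/
def convIntegrand {d : ℕ} (g f : Sphere d → ℂ) (ω x : Sphere d) : ℂ :=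
  profile g (sphereInner ω x) * f x

/-- The convolution `(g ∗ f)(ω) = ∫ g♭(⟨ω, x⟩) f(x) dσ(x)`. -/
def zonalConv {d : ℕ} (g f : Sphere d → ℂ) (ω : Sphere d) : ℂ :=
  ∫ x, convIntegrand g f ω x ∂(surfaceMeasure d)

end SphereMultiplier

end

open SphereMultiplier

namespace SphereMultiplier

open MvPolynomial

/-! Let `K_n` be the reproducing kernel of `Π_n` in `L²(𝕊^d)`. The operator is integration against
`G(x, y) = K_{2L}(x, y) K_L(x, y) / K_L(N, N)`, a substitute for a de la Vallée Poussin kernel that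
needs no asymptotics of special functions.

Range: as a function of `x`, `G` is a product of elements of `Π_{2L}` and `Π_L`, hence lies in
`Π_{3L}`. Identity on `Π_L`: for `f ∈ Π_L` the product `K_L(x, ·) f` lies in `Π_{2L}`, so `K_{2L}`
evaluates it at `x` and gives `K_L(x, x) f(x)`; the diagonal is constant. Both use that `Π_n`
consists of all restrictions of polynomials of degree at most `n`, so that degrees add under
products.

Norm: `∫ |K_n(x, y)|² dσ(y) = K_n(x, x) = dim Π_n / σ(𝕊^d)`, so `2ab ≤ a² + b²` bounds `∫ |G(x, y)|
dσ(y)` by a multiple of `1 + dim Π_{2L} / dim Π_L`. The doubling estimate `dim Π_{2L} ≤ 2^(d+1) dim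
Π_L` makes this uniform in `L`, and Schur's test turns it into an `L^p` bound for every `p`.

Zonality: `K_n` does not depend on the orthonormal basis, so it is invariant under all linear
isometries, reflections included. Hence `G(x, y)` depends only on `⟨x, y⟩`, also when `d = 1`. -/

/-! ### Harmonic decomposition: `Π_n` as the restrictions of polynomials of degree at most `n` -/

theorem restrictToSphere_apply {d : ℕ} (P : MvPolynomial (Fin (d + 1)) ℂ) (ω : Sphere d) :
    restrictToSphere d P ω =
      eval (fun i => (((ω : EuclideanSpace ℝ (Fin (d + 1))) i : ℝ) : ℂ)) P := rfl

theorem restrictToSphere_mul {d : ℕ} (P Q : MvPolynomial (Fin (d + 1)) ℂ) :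
    restrictToSphere d (P * Q) = restrictToSphere d P * restrictToSphere d Q := by
  ext ω
  simp [restrictToSphere_apply]

theorem restrictToSphere_one {d : ℕ} : restrictToSphere d 1 = 1 := by
  ext ω
  simp [restrictToSphere_apply]

theorem Sphere.sum_sq {d : ℕ} (ω : Sphere d) :
    ∑ i, ((ω : EuclideanSpace ℝ (Fin (d + 1))) i) ^ 2 = 1 := by
  have h := EuclideanSpace.real_norm_sq_eq (ω : EuclideanSpace ℝ (Fin (d + 1)))
  rw [← h]
  simp

/-- The polynomial `∑ i, X i ^ 2`. -/
noncomputable def sqNormPoly (d : ℕ) : MvPolynomial (Fin (d + 1)) ℂ := ∑ i, X i ^ 2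

theorem restrictToSphere_sqNormPoly (d : ℕ) : restrictToSphere d (sqNormPoly d) = 1 := by
  ext ω
  have := Sphere.sum_sq ω
  rw [restrictToSphere_apply, sqNormPoly, map_sum]
  simp only [map_pow, eval_X, ContinuousMap.one_apply]
  exact_mod_cast this

theorem restrictToSphere_sqNormPoly_pow_mul {d : ℕ} (m : ℕ) (P : MvPolynomial (Fin (d + 1)) ℂ) :
    restrictToSphere d (sqNormPoly d ^ m * P) = restrictToSphere d P := by
  induction m with
  | zero => simp
  | succ m ih => rw [pow_succ', mul_assoc, restrictToSphere_mul, ih, restrictToSphere_sqNormPoly,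
      one_mul]

theorem sqNormPoly_isHomogeneous (d : ℕ) : (sqNormPoly d).IsHomogeneous 2 :=
  IsHomogeneous.sum _ _ _ fun i _ => isHomogeneous_X_pow i 2

theorem polyLaplacian_apply {d : ℕ} (P : MvPolynomial (Fin (d + 1)) ℂ) :
    polyLaplacian d P = ∑ i, pderiv i (pderiv i P) := by
  simp [polyLaplacian]

theorem polyLaplacian_isHomogeneous {d n : ℕ} {P : MvPolynomial (Fin (d + 1)) ℂ}
    (h : P.IsHomogeneous n) : (polyLaplacian d P).IsHomogeneous (n - 2) := by
  rw [polyLaplacian_apply]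
  exact IsHomogeneous.sum _ _ _ fun i _ => h.pderiv.pderiv

theorem polyLaplacian_pow_isHomogeneous {d n : ℕ} {P : MvPolynomial (Fin (d + 1)) ℂ}
    (h : P.IsHomogeneous n) (m : ℕ) : ((polyLaplacian d ^ m) P).IsHomogeneous (n - 2 * m) := by
  induction m with
  | zero => simpa using h
  | succ m ih =>
    rw [pow_succ', Module.End.mul_apply]
    exact polyLaplacian_isHomogeneous ih

theorem pderiv_sqNormPoly {d : ℕ} (i : Fin (d + 1)) :
    pderiv i (sqNormPoly d) = 2 * X i := by
  classical
  simp only [sqNormPoly, map_sum, Derivation.leibniz_pow, pderiv_X]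
  rw [Finset.sum_eq_single i]
  · simp [mul_comm]
  · intro j _ hj
    simp [hj]
  · simp

/-- Leibniz rule; the cross terms `4 ∑ X i ∂ᵢQ` collapse to `4 n Q` by Euler's identity. -/
theorem polyLaplacian_sqNormPoly_mul {d n : ℕ} {Q : MvPolynomial (Fin (d + 1)) ℂ}
    (h : Q.IsHomogeneous n) :
    polyLaplacian d (sqNormPoly d * Q) =
      ((2 * (d + 1) + 4 * n : ℕ) : MvPolynomial (Fin (d + 1)) ℂ) * Q
        + sqNormPoly d * polyLaplacian d Q := by
  have key : ∀ i, pderiv i (pderiv i (sqNormPoly d * Q)) =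
      2 * Q + 4 * (X i * pderiv i Q) + sqNormPoly d * pderiv i (pderiv i Q) := by
    intro i
    have h2 : pderiv i (2 : MvPolynomial (Fin (d + 1)) ℂ) = 0 := by
      exact (pderiv i).map_natCast 2
    simp only [Derivation.leibniz, map_add, pderiv_sqNormPoly, smul_eq_mul, h2, pderiv_X_self]
    ring
  have e := h.sum_X_mul_pderiv
  rw [polyLaplacian_apply, polyLaplacian_apply, Finset.sum_congr rfl fun i _ => key i,
    Finset.sum_add_distrib, Finset.sum_add_distrib, ← Finset.mul_sum, ← Finset.mul_sum, e]
  simp [Finset.mul_sum]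
  ring

theorem exists_polyLaplacian_sqNormPoly_pow_mul {d n : ℕ} {H : MvPolynomial (Fin (d + 1)) ℂ}
    (h : H.IsHomogeneous n) (hH : polyLaplacian d H = 0) (j : ℕ) :
    ∃ c : ℕ, 0 < c ∧ polyLaplacian d (sqNormPoly d ^ (j + 1) * H) =
      (c : MvPolynomial (Fin (d + 1)) ℂ) * (sqNormPoly d ^ j * H) := by
  induction j with
  | zero =>
    refine ⟨2 * (d + 1) + 4 * n, by positivity, ?_⟩
    rw [zero_add, pow_one, polyLaplacian_sqNormPoly_mul h, hH]
    simp
  | succ j ih =>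
    obtain ⟨c, hc, ih⟩ := ih
    refine ⟨2 * (d + 1) + 4 * (2 * (j + 1) + n) + c, by positivity, ?_⟩
    rw [pow_succ' _ (j + 1), mul_assoc,
      polyLaplacian_sqNormPoly_mul (((sqNormPoly_isHomogeneous d).pow (j + 1)).mul h), ih]
    push_cast
    ring

/-- Only the positivity of `c` matters: it can be divided out when a harmonic component is peeled
off. -/
theorem exists_polyLaplacian_pow_sqNormPoly_pow_mul {d n : ℕ} {H : MvPolynomial (Fin (d + 1)) ℂ}
    (h : H.IsHomogeneous n) (hH : polyLaplacian d H = 0) (m : ℕ) :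
    ∃ c : ℕ, 0 < c ∧ (polyLaplacian d ^ m) (sqNormPoly d ^ m * H) = c • H := by
  induction m with
  | zero => exact ⟨1, one_pos, by simp⟩
  | succ m ih =>
    obtain ⟨c, hc, ih⟩ := ih
    obtain ⟨c', hc', h'⟩ := exists_polyLaplacian_sqNormPoly_pow_mul h hH m
    refine ⟨c' * c, by positivity, ?_⟩
    rw [pow_succ, Module.End.mul_apply, h', ← nsmul_eq_mul, map_nsmul, ih, smul_smul]

theorem harmonicSpace_le_harmonicsUpTo {d ℓ n : ℕ} (h : ℓ ≤ n) :
    harmonicSpace d ℓ ≤ harmonicsUpTo d n :=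
  le_iSup₂_of_le ℓ (by simpa [Nat.lt_succ_iff] using h) le_rfl

/-- If `Δ^(m+1) P = 0`, then `H = Δ^m P` is harmonic, and subtracting a suitable multiple of
`|x|^(2m) H` from `P` leaves a polynomial killed by `Δ^m`. On the sphere `|x|^(2m) H` equals `H`, so
the subtracted term restricts to a spherical harmonic. -/
theorem restrictToSphere_mem_of_polyLaplacian_pow_eq_zero {d k n : ℕ} (hk : k ≤ n) (m : ℕ) :
    ∀ P : MvPolynomial (Fin (d + 1)) ℂ, P.IsHomogeneous k → (polyLaplacian d ^ m) P = 0 →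
      restrictToSphere d P ∈ harmonicsUpTo d n := by
  induction m with
  | zero =>
    intro P _ h0
    have : P = 0 := by simpa using h0
    simp [this]
  | succ m ih =>
    intro P hP h0
    by_cases hm : 2 * m ≤ k
    · set H := (polyLaplacian d ^ m) P with hHdef
      have hHh : H.IsHomogeneous (k - 2 * m) := polyLaplacian_pow_isHomogeneous hP m
      have hH0 : polyLaplacian d H = 0 := by
        rw [hHdef, ← Module.End.mul_apply, ← pow_succ', h0]
      obtain ⟨c, hc, hcH⟩ := exists_polyLaplacian_pow_sqNormPoly_pow_mul hHh hH0 m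
      have hc' : (c : ℂ) ≠ 0 := by exact_mod_cast hc.ne'
      have hQ : (sqNormPoly d ^ m * H).IsHomogeneous k := by
        have := ((sqNormPoly_isHomogeneous d).pow m).mul hHh
        rwa [Nat.add_sub_cancel' hm] at this
      have h1 : restrictToSphere d (P - (c : ℂ)⁻¹ • (sqNormPoly d ^ m * H)) ∈
          harmonicsUpTo d n := by
        refine ih _ (hP.sub ?_) ?_
        · exact Submodule.smul_mem (homogeneousSubmodule (Fin (d + 1)) ℂ k) _ hQ
        · rw [map_sub, map_smul, hcH, ← hHdef, ← Nat.cast_smul_eq_nsmul ℂ, smul_smul,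
            inv_mul_cancel₀ hc', one_smul, sub_self]
      have h2 : restrictToSphere d H ∈ harmonicsUpTo d n :=
        harmonicSpace_le_harmonicsUpTo ((Nat.sub_le _ _).trans hk) ⟨H, ⟨hHh, hH0⟩, rfl⟩
      rw [map_sub, map_smul, restrictToSphere_sqNormPoly_pow_mul] at h1
      have := Submodule.add_mem _ h1 (Submodule.smul_mem _ (c : ℂ)⁻¹ h2)
      simpa using this
    -- When `2m > k`, already `Δ^m P = 0`: after `m - 1` Laplacians the degree is at most one, so
    -- the first derivatives are constants.
    · refine ih P hP ?_
      obtain ⟨m, rfl⟩ : ∃ m', m = m' + 1 := ⟨m - 1, by omega⟩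
      rw [pow_succ', Module.End.mul_apply, polyLaplacian_apply]
      refine Finset.sum_eq_zero fun i _ => ?_
      have h4 := (polyLaplacian_pow_isHomogeneous hP m).pderiv (i := i)
      rw [show k - 2 * m - 1 = 0 by omega] at h4
      rw [← totalDegree_zero_iff_isHomogeneous, totalDegree_eq_zero_iff_eq_C] at h4
      rw [h4, pderiv_C]

theorem restrictToSphere_mem_of_isHomogeneous {d k n : ℕ} (hk : k ≤ n)
    {P : MvPolynomial (Fin (d + 1)) ℂ} (hP : P.IsHomogeneous k) :
    restrictToSphere d P ∈ harmonicsUpTo d n := by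
  -- `Δ^k P` has degree `k - 2 * k`, truncated to `0`, hence is constant; one more Laplacian kills
  -- it.
  refine restrictToSphere_mem_of_polyLaplacian_pow_eq_zero hk (k + 1) P hP ?_
  have h4 := polyLaplacian_pow_isHomogeneous hP k
  rw [show k - 2 * k = 0 by omega, ← totalDegree_zero_iff_isHomogeneous,
    totalDegree_eq_zero_iff_eq_C] at h4
  rw [pow_succ', Module.End.mul_apply, h4, polyLaplacian_apply]
  simp

/-- `Π_n` consists of the restrictions of all polynomials of degree at most `n`. -/
theorem harmonicsUpTo_eq_map (d n : ℕ) :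
    harmonicsUpTo d n =
      (restrictTotalDegree (Fin (d + 1)) ℂ n).map (restrictToSphere d) := by
  apply le_antisymm
  · refine iSup₂_le fun ℓ hℓ => Submodule.map_mono fun P hP => ?_
    rw [mem_restrictTotalDegree]
    exact (IsHomogeneous.totalDegree_le hP.1).trans (by simpa [Nat.lt_succ_iff] using hℓ)
  · rintro _ ⟨P, hP, rfl⟩
    have hP' : P.totalDegree ≤ n := (mem_restrictTotalDegree _ _ _).1 hP
    rw [← sum_homogeneousComponent P, map_sum]
    refine Submodule.sum_mem _ fun i hi => restrictToSphere_mem_of_isHomogeneous ?_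
      (homogeneousComponent_isHomogeneous i P)
    have := Finset.mem_range.1 hi
    omega

theorem mem_harmonicsUpTo_iff {d n : ℕ} {f : C(Sphere d, ℂ)} :
    f ∈ harmonicsUpTo d n ↔
      ∃ P : MvPolynomial (Fin (d + 1)) ℂ, P.totalDegree ≤ n ∧ restrictToSphere d P = f := by
  rw [harmonicsUpTo_eq_map]
  simp [Submodule.mem_map, mem_restrictTotalDegree]

theorem mul_mem_harmonicsUpTo {d m n : ℕ} {f g : C(Sphere d, ℂ)}
    (hf : f ∈ harmonicsUpTo d m) (hg : g ∈ harmonicsUpTo d n) :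
    f * g ∈ harmonicsUpTo d (m + n) := by
  obtain ⟨P, hP, rfl⟩ := mem_harmonicsUpTo_iff.1 hf
  obtain ⟨Q, hQ, rfl⟩ := mem_harmonicsUpTo_iff.1 hg
  exact mem_harmonicsUpTo_iff.2 ⟨P * Q, (totalDegree_mul P Q).trans (add_le_add hP hQ),
    restrictToSphere_mul P Q⟩

theorem one_mem_harmonicsUpTo (d n : ℕ) : (1 : C(Sphere d, ℂ)) ∈ harmonicsUpTo d n :=
  mem_harmonicsUpTo_iff.2 ⟨1, by simp, restrictToSphere_one⟩

instance (d n : ℕ) : FiniteDimensional ℂ (harmonicsUpTo d n) := by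
  rw [harmonicsUpTo_eq_map]
  infer_instance

/-! ### Invariance of `Π_n` under linear isometries -/

/-- The action of a linear isometry on the sphere as a continuous map. -/
noncomputable def sphereAction {d : ℕ}
    (ρ : EuclideanSpace ℝ (Fin (d + 1)) ≃ₗᵢ[ℝ] EuclideanSpace ℝ (Fin (d + 1))) :
    C(Sphere d, Sphere d) where
  toFun := actOnSphere ρ
  continuous_toFun := by
    unfold actOnSphere
    fun_prop

/-- Composing with an isometry substitutes linear forms for the variables, which keeps homogeneity
and degree; that the Laplacian commutes with isometries is not needed. -/
theorem comp_sphereAction_mem_harmonicsUpTo {d n : ℕ}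
    (ρ : EuclideanSpace ℝ (Fin (d + 1)) ≃ₗᵢ[ℝ] EuclideanSpace ℝ (Fin (d + 1)))
    {f : C(Sphere d, ℂ)} (hf : f ∈ harmonicsUpTo d n) :
    f.comp (sphereAction ρ) ∈ harmonicsUpTo d n := by
  suffices h : harmonicsUpTo d n ≤ (harmonicsUpTo d n).comap
      (ContinuousMap.compRightAlgHom ℂ ℂ (sphereAction ρ)).toLinearMap from h hf
  refine iSup₂_le fun ℓ hℓ => ?_
  rintro _ ⟨P, hP, rfl⟩
  have h1 : (MvPolynomial.aeval (fun i => ∑ j,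
      C ((ρ (EuclideanSpace.single j 1) i : ℝ) : ℂ) * X j) P :
      MvPolynomial (Fin (d + 1)) ℂ).IsHomogeneous (1 * ℓ) :=
    IsHomogeneous.aeval hP.1 _ fun i => IsHomogeneous.sum _ _ _ fun j _ =>
      isHomogeneous_C_mul_X _ _
  have h2 := restrictToSphere_mem_of_isHomogeneous (n := n)
    (by simpa [Nat.lt_succ_iff] using hℓ) h1
  change (restrictToSphere d P).comp (sphereAction ρ) ∈ harmonicsUpTo d n
  convert h2 using 1
  refine ContinuousMap.ext fun ω : Sphere d => ?_
  change restrictToSphere d P (actOnSphere ρ ω) = _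
  rw [restrictToSphere_apply, restrictToSphere_apply, ← MvPolynomial.coe_aeval_eq_eval,
    ← MvPolynomial.coe_aeval_eq_eval]
  simp only [RingHom.coe_coe]
  rw [← AlgHom.comp_apply, MvPolynomial.comp_aeval]
  congr 2
  ext i
  have h3 : (ω : EuclideanSpace ℝ (Fin (d + 1))) =
      ∑ j, ((ω : EuclideanSpace ℝ (Fin (d + 1))) j) • EuclideanSpace.single j (1 : ℝ) := by
    have := ((EuclideanSpace.basisFun (Fin (d + 1)) ℝ).sum_repr (ω : EuclideanSpace ℝ _)).symm
    simpa using this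
  have h4 : (ρ ω) i = ∑ j, (ω : EuclideanSpace ℝ (Fin (d + 1))) j *
      ρ (EuclideanSpace.single j 1) i := by
    conv_lhs => rw [h3]
    simp
  simp only [actOnSphere, h4]
  simp [mul_comm]


/-! ### Doubling estimate for `dim Π_L` -/

/-- The restriction to the sphere of a polynomial in the first `d` coordinates. -/
noncomputable def restrictFirst (d : ℕ) : MvPolynomial (Fin d) ℂ →ₗ[ℂ] C(Sphere d, ℂ) :=
  restrictToSphere d ∘ₗ (rename Fin.castSucc).toLinearMap

/-- The first `d` coordinates of points of the sphere fill a small cube, and a polynomial vanishing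
on a product of infinite sets is zero. -/
theorem restrictFirst_injective (d : ℕ) : Function.Injective (restrictFirst d) := by
  rw [← LinearMap.ker_eq_bot, LinearMap.ker_eq_bot']
  intro p hp
  -- On this interval `t² ≤ t ≤ 1 / (d + 1)`, so `d` such squares sum to at most one and leave room
  -- for the last coordinate.
  let s : Set ℂ := (fun t : ℝ => (t : ℂ)) '' Set.Icc 0 (1 / ((d : ℝ) + 1))
  have hs : s.Infinite := (Set.Icc_infinite (by positivity)).image
    (Complex.ofReal_injective.injOn)
  refine MvPolynomial.funext_set (fun _ => s) (fun _ => hs) fun x hx => ?_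
  choose t ht htx using fun i => hx i trivial
  have hsum : ∑ i, t i ^ 2 ≤ 1 := by
    calc ∑ i, t i ^ 2 ≤ ∑ _i : Fin d, (1 / ((d : ℝ) + 1)) := by
          refine Finset.sum_le_sum fun i _ => ?_
          have h1 : (1 / ((d : ℝ) + 1)) ≤ 1 := by
            rw [div_le_one (by positivity)]
            linarith [(Nat.cast_nonneg d : (0 : ℝ) ≤ d)]
          have h0 := ht i
          nlinarith [h0.1, h0.2]
      _ ≤ 1 := by
          simp only [Finset.sum_const, Finset.card_univ, Fintype.card_fin, nsmul_eq_mul]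
          rw [mul_one_div, div_le_one (by positivity)]
          linarith
  let v : EuclideanSpace ℝ (Fin (d + 1)) :=
    WithLp.toLp 2 (Fin.snoc (α := fun _ => ℝ) t (Real.sqrt (1 - ∑ i, t i ^ 2)))
  have hv : ‖v‖ = 1 := by
    rw [← sq_eq_sq₀ (norm_nonneg _) zero_le_one, EuclideanSpace.real_norm_sq_eq,
      Fin.sum_univ_castSucc]
    simp only [v, Fin.snoc_castSucc, Fin.snoc_last]
    rw [Real.sq_sqrt (by linarith)]
    ring
  have h := DFunLike.congr_fun hp (⟨v, by simpa using hv⟩ : Sphere d)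
  change restrictToSphere d (rename Fin.castSucc p) _ = 0 at h
  rw [restrictToSphere_apply, eval_rename] at h
  rw [map_zero, ← h]
  congr 2
  ext i
  simp [v, ← htx]

/-- The functions `∑ ε, (∏ i ∈ ε, x i) * p ε (x 0 ^ 2, …, x (d - 1) ^ 2)` on the sphere. -/
noncomputable def squareCombination (d L : ℕ) :
    (Finset (Fin (d + 1)) → restrictTotalDegree (Fin d) ℂ L) →ₗ[ℂ] C(Sphere d, ℂ) :=
  ∑ ε : Finset (Fin (d + 1)), LinearMap.mulLeft ℂ (restrictToSphere d (∏ i ∈ ε, X i)) ∘ₗ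
    restrictToSphere d ∘ₗ
    (MvPolynomial.aeval fun i : Fin d =>
      (X i.castSucc ^ 2 : MvPolynomial (Fin (d + 1)) ℂ)).toLinearMap ∘ₗ
    (restrictTotalDegree (Fin d) ℂ L).subtype ∘ₗ LinearMap.proj ε

/-- Split each exponent into its parity and an even part: the parities form a squarefree monomial,
and the even part is a monomial of degree at most `L` in the squares. -/
theorem restrictToSphere_monomial_mem_range {d L : ℕ} (α : Fin (d + 1) →₀ ℕ)
    (hα : α.degree ≤ 2 * L) :
    restrictToSphere d (monomial α 1) ∈ (squareCombination d L).range := by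
  classical
  -- The square of the last coordinate is eliminated through `x_d² = 1 - ∑ x_i²`, which is linear in
  -- the other squares and so costs no degree.
  let q : MvPolynomial (Fin d) ℂ :=
    (∏ i, X i ^ (α i.castSucc / 2)) * (1 - ∑ i, X i) ^ (α (Fin.last d) / 2)
  have hq : q.totalDegree ≤ L := by
    have h1 : (∏ i : Fin d, (X i : MvPolynomial (Fin d) ℂ) ^ (α i.castSucc / 2)).totalDegree ≤
        ∑ i : Fin d, α i.castSucc / 2 :=
      (totalDegree_finsetProd _ _).trans (Finset.sum_le_sum fun i _ => by simp)
    have h2 : (1 - ∑ i, X i : MvPolynomial (Fin d) ℂ).totalDegree ≤ 1 := by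
      refine (totalDegree_sub _ _).trans (max_le (by simp) ?_)
      exact (totalDegree_finsetSum_le fun i _ => by simp)
    have h3 := (totalDegree_pow (1 - ∑ i, X i : MvPolynomial (Fin d) ℂ) (α (Fin.last d) / 2)).trans
      (Nat.mul_le_mul_left _ h2)
    have h4 : 2 * ∑ i : Fin d, α i.castSucc / 2 ≤ ∑ i : Fin d, α i.castSucc := by
      rw [Finset.mul_sum]
      exact Finset.sum_le_sum fun i _ => Nat.mul_div_le _ _
    rw [Finsupp.degree_eq_sum, Fin.sum_univ_castSucc] at hα
    have h5 := (totalDegree_mul (∏ i : Fin d, (X i : MvPolynomial (Fin d) ℂ) ^ (α i.castSucc / 2))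
      ((1 - ∑ i, X i) ^ (α (Fin.last d) / 2)))
    refine h5.trans ?_
    omega
  let ε : Finset (Fin (d + 1)) := Finset.univ.filter fun i => α i % 2 = 1
  refine ⟨Pi.single ε ⟨q, (mem_restrictTotalDegree _ _ _).2 hq⟩, ?_⟩
  simp only [squareCombination, LinearMap.sum_apply, LinearMap.comp_apply, LinearMap.proj_apply]
  rw [Finset.sum_eq_single ε (fun b _ hb => by simp [hb]) (by simp)]
  refine ContinuousMap.ext fun ω : Sphere d => ?_
  set w : Fin (d + 1) → ℂ := fun i => (((ω : EuclideanSpace ℝ (Fin (d + 1))) i : ℝ) : ℂ) with hw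
  have hlast : 1 - ∑ i : Fin d, w i.castSucc ^ 2 = w (Fin.last d) ^ 2 := by
    have := Sphere.sum_sq ω
    rw [Fin.sum_univ_castSucc] at this
    rw [sub_eq_iff_eq_add']
    simp only [hw]
    exact_mod_cast this.symm
  have hε : ∏ i ∈ ε, w i = ∏ i, w i ^ (α i % 2) := by
    rw [Finset.prod_filter]
    refine Finset.prod_congr rfl fun i _ => ?_
    rcases Nat.mod_two_eq_zero_or_one (α i) with h | h <;> simp [h]
  have hR : restrictToSphere d (monomial α 1) ω = ∏ i, w i ^ α i := by
    rw [restrictToSphere_apply, eval_monomial, one_mul, Finsupp.prod_fintype _ _ (by simp)]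
  have hL : restrictToSphere d (aeval (fun i : Fin d =>
      (X i.castSucc ^ 2 : MvPolynomial (Fin (d + 1)) ℂ)) q) ω = ∏ i, (w i ^ 2) ^ (α i / 2) := by
    rw [restrictToSphere_apply, ← hw, Fin.prod_univ_castSucc, ← hlast]
    simp [q]
  have hM : restrictToSphere d (∏ i ∈ ε, X i) ω = ∏ i ∈ ε, w i := by
    rw [restrictToSphere_apply, ← hw]
    simp
  simp only [Pi.single_eq_same, Submodule.subtype_apply, AlgHom.toLinearMap_apply,
    LinearMap.mulLeft_apply, ContinuousMap.mul_apply]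
  rw [hR, hL, hM, hε, ← Finset.prod_mul_distrib]
  refine Finset.prod_congr rfl fun i _ => ?_
  rw [← pow_mul, ← pow_add, Nat.mod_add_div]

/-- Doubling estimate for the dimension of `Π_L`. -/
theorem finrank_harmonicsUpTo_two_mul_le (d L : ℕ) :
    Module.finrank ℂ (harmonicsUpTo d (2 * L)) ≤
      2 ^ (d + 1) * Module.finrank ℂ (harmonicsUpTo d L) := by
  have h1 : harmonicsUpTo d (2 * L) ≤ (squareCombination d L).range := by
    intro f hf
    obtain ⟨P, hP, rfl⟩ := mem_harmonicsUpTo_iff.1 hf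
    rw [P.as_sum, map_sum]
    refine Submodule.sum_mem _ fun α hα => ?_
    rw [← mul_one (coeff α P), ← smul_eq_mul, ← smul_monomial, map_smul]
    refine Submodule.smul_mem _ _ (restrictToSphere_monomial_mem_range α ?_)
    rw [Finsupp.degree_eq_sum]
    have := le_totalDegree hα
    rw [Finsupp.sum_fintype _ _ (by simp)] at this
    exact this.trans hP
  -- Each of the `2^(d+1)` parity patterns contributes a copy of this polynomial space, which embeds
  -- in `Π_L`.
  have h2 : Module.finrank ℂ (restrictTotalDegree (Fin d) ℂ L) ≤
      Module.finrank ℂ (harmonicsUpTo d L) := by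
    have hmem : ∀ p : restrictTotalDegree (Fin d) ℂ L,
        (restrictFirst d ∘ₗ (restrictTotalDegree (Fin d) ℂ L).subtype) p ∈ harmonicsUpTo d L :=
      fun p => mem_harmonicsUpTo_iff.2 ⟨rename Fin.castSucc p.1, (totalDegree_rename_le _ _).trans
        ((mem_restrictTotalDegree _ _ _).1 p.2), rfl⟩
    refine LinearMap.finrank_le_finrank_of_injective
      (f := LinearMap.codRestrict (harmonicsUpTo d L) _ hmem) ?_
    intro p q hpq
    exact Subtype.ext (restrictFirst_injective d (congrArg Subtype.val hpq))
  calc Module.finrank ℂ (harmonicsUpTo d (2 * L))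
      ≤ Module.finrank ℂ (squareCombination d L).range := Submodule.finrank_mono h1
    _ ≤ Module.finrank ℂ (Finset (Fin (d + 1)) → restrictTotalDegree (Fin d) ℂ L) :=
        LinearMap.finrank_range_le _
    _ = 2 ^ (d + 1) * Module.finrank ℂ (restrictTotalDegree (Fin d) ℂ L) := by
        rw [Module.finrank_pi_fintype]
        simp
    _ ≤ _ := Nat.mul_le_mul_left _ h2


/-! ### Isometries of the sphere and invariant kernels -/

open scoped Pointwise in
-- The surface measure of a set is a constant times the volume of the cone over it, and a linear
-- isometry maps cones to cones and preserves volume.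
theorem measurePreserving_actOnSphere {d : ℕ}
    (ρ : EuclideanSpace ℝ (Fin (d + 1)) ≃ₗᵢ[ℝ] EuclideanSpace ℝ (Fin (d + 1))) :
    MeasurePreserving (actOnSphere ρ) (surfaceMeasure d) (surfaceMeasure d) := by
  have hc : Continuous (actOnSphere ρ) := by
    unfold actOnSphere
    fun_prop
  refine ⟨hc.measurable, Measure.ext fun s hs => ?_⟩
  rw [Measure.map_apply hc.measurable hs, surfaceMeasure, Measure.toSphere_apply' _ hs,
    Measure.toSphere_apply' _ (hc.measurable hs)]
  congr 1
  rw [← (LinearIsometryEquiv.measurePreserving ρ).measure_preimage_emb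
    ρ.toHomeomorph.measurableEmbedding
    (Set.Ioo (0 : ℝ) 1 • (Subtype.val '' s : Set (EuclideanSpace ℝ (Fin (d + 1)))))]
  congr 1
  ext v
  simp only [Set.mem_smul, Set.mem_image, Set.mem_preimage]
  constructor
  · rintro ⟨r, hr, _, ⟨ω, hω, rfl⟩, rfl⟩
    exact ⟨r, hr, _, ⟨_, hω, rfl⟩, by simp [actOnSphere]⟩
  · rintro ⟨r, hr, _, ⟨ω, hω, rfl⟩, h⟩
    change r • (ω : EuclideanSpace ℝ (Fin (d + 1))) = ρ v at h
    refine ⟨r, hr, _, ⟨actOnSphere ρ.symm ω, ?_, rfl⟩, ?_⟩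
    · convert hω
      ext1
      simp [actOnSphere]
    · apply ρ.injective
      simp [actOnSphere, h]

/-- The reflection in the hyperplane orthogonal to `x - y` exchanges `x` and `y`; the hypothesis
says that `z` lies in that hyperplane. It is in general not a rotation, which is why kernels are
required to be invariant under all isometries. -/
theorem exists_isometry_map_eq {d : ℕ} (x y z : Sphere d)
    (h : sphereInner x z = sphereInner y z) :
    ∃ ρ : EuclideanSpace ℝ (Fin (d + 1)) ≃ₗᵢ[ℝ] EuclideanSpace ℝ (Fin (d + 1)),
      actOnSphere ρ x = y ∧ actOnSphere ρ z = z := by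
  refine ⟨(ℝ ∙ ((x : EuclideanSpace ℝ (Fin (d + 1))) - y))ᗮ.reflection, ?_, ?_⟩
  · ext1
    exact Submodule.reflection_sub (by simp)
  · ext1
    refine Submodule.reflection_mem_subspace_eq_self ?_
    rw [Submodule.mem_orthogonal_singleton_iff_inner_right, inner_sub_left]
    exact sub_eq_zero.2 h

theorem exists_isometry_swap {d : ℕ} (x y : Sphere d) :
    ∃ ρ : EuclideanSpace ℝ (Fin (d + 1)) ≃ₗᵢ[ℝ] EuclideanSpace ℝ (Fin (d + 1)),
      actOnSphere ρ x = y ∧ actOnSphere ρ y = x := by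
  have h : (ℝ ∙ ((x : EuclideanSpace ℝ (Fin (d + 1))) - y))ᗮ.reflection x = y :=
    Submodule.reflection_sub (by simp)
  refine ⟨(ℝ ∙ ((x : EuclideanSpace ℝ (Fin (d + 1))) - y))ᗮ.reflection, ?_, ?_⟩
  · ext1
    exact h
  · ext1
    have h2 := congrArg (Submodule.reflection (ℝ ∙ ((x : EuclideanSpace ℝ (Fin (d + 1))) - y))ᗮ) h
    rw [Submodule.reflection_reflection] at h2
    exact h2.symm

theorem sphereInner_actOnSphere {d : ℕ}
    (ρ : EuclideanSpace ℝ (Fin (d + 1)) ≃ₗᵢ[ℝ] EuclideanSpace ℝ (Fin (d + 1)))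
    (x y : Sphere d) : sphereInner (actOnSphere ρ x) (actOnSphere ρ y) = sphereInner x y :=
  ρ.inner_map_map _ _

/-- A function of two points of the sphere that is invariant under all linear isometries. -/
def IsIsometryInvariant {d : ℕ} (G : Sphere d → Sphere d → ℂ) : Prop :=
  ∀ (ρ : EuclideanSpace ℝ (Fin (d + 1)) ≃ₗᵢ[ℝ] EuclideanSpace ℝ (Fin (d + 1)))
    (x y : Sphere d), G (actOnSphere ρ x) (actOnSphere ρ y) = G x y

namespace IsIsometryInvariant

variable {d : ℕ} {G : Sphere d → Sphere d → ℂ}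

theorem swap (hG : IsIsometryInvariant G) (x y : Sphere d) : G x y = G y x := by
  obtain ⟨ρ, h1, h2⟩ := exists_isometry_swap x y
  rw [← hG ρ x y, h1, h2]

theorem diag (hG : IsIsometryInvariant G) (x y : Sphere d) : G x x = G y y := by
  obtain ⟨ρ, h1, h2⟩ := exists_isometry_swap x y
  rw [← hG ρ x x, h1]

theorem isZonal (hG : IsIsometryInvariant G) : IsZonal fun ω => G ω (northPole d) := by
  intro ρ _ hN ω
  conv_lhs => rw [← hN]
  exact hG ρ ω _

theorem hasProfile (hG : IsIsometryInvariant G) : HasProfile fun ω => G ω (northPole d) := by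
  intro ω
  refine Function.FactorsThrough.extend_apply (fun x y hxy => ?_) _ ω
  obtain ⟨ρ, h1, h2⟩ := exists_isometry_map_eq x y (northPole d) hxy
  rw [← hG ρ x, h1, h2]

/-- An isometry carrying `x` to the pole reduces this to the defining equation of the profile. It
identifies zonal convolution with integration against `G`. -/
theorem profile_sphereInner (hG : IsIsometryInvariant G) (ω x : Sphere d) :
    profile (fun ω => G ω (northPole d)) (sphereInner ω x) = G ω x := by
  obtain ⟨ρ, -, h⟩ := exists_isometry_swap (northPole d) x
  rw [← sphereInner_actOnSphere ρ, h, hG.hasProfile]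
  change G _ (northPole d) = _
  rw [← h, hG]

end IsIsometryInvariant


/-! ### Orthonormal families in `L²(𝕊^d)` and their reproducing kernels -/

open scoped ComplexConjugate

theorem integrable_of_continuous {d : ℕ} {f : Sphere d → ℂ} (hf : Continuous f) :
    Integrable f (surfaceMeasure d) :=
  hf.integrable_of_hasCompactSupport (HasCompactSupport.of_compactSpace f)

instance (d : ℕ) : (surfaceMeasure d).IsOpenPosMeasure := by
  unfold surfaceMeasure
  infer_instance

theorem surfaceMeasure_real_univ_pos (d : ℕ) : 0 < (surfaceMeasure d).real Set.univ := by
  have : Nonempty (Sphere d) := ⟨northPole d⟩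
  exact ENNReal.toReal_pos (isOpen_univ.measure_ne_zero _ Set.univ_nonempty) (measure_ne_top _ _)

theorem integral_comp_actOnSphere {d : ℕ}
    (ρ : EuclideanSpace ℝ (Fin (d + 1)) ≃ₗᵢ[ℝ] EuclideanSpace ℝ (Fin (d + 1)))
    {f : Sphere d → ℂ} (hf : Continuous f) :
    ∫ x, f (actOnSphere ρ x) ∂surfaceMeasure d = ∫ x, f x ∂surfaceMeasure d := by
  have h := measurePreserving_actOnSphere ρ
  conv_rhs => rw [← h.map_eq]
  rw [integral_map h.measurable.aemeasurable]
  rw [h.map_eq]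
  exact (integrable_of_continuous hf).aestronglyMeasurable

/-- The scalar product of `L²(𝕊^d)` for continuous functions. -/
noncomputable def sphereL2Inner {d : ℕ} (f g : C(Sphere d, ℂ)) : ℂ :=
  ∫ x, g x * conj (f x) ∂surfaceMeasure d

theorem conj_sphereL2Inner {d : ℕ} (f g : C(Sphere d, ℂ)) :
    conj (sphereL2Inner f g) = sphereL2Inner g f := by
  rw [sphereL2Inner, sphereL2Inner, ← integral_conj]
  simp [mul_comm]

/-- A finite orthonormal family, spanning the space `V` of continuous functions. -/
structure IsL2Basis {d n : ℕ} (V : Submodule ℂ C(Sphere d, ℂ)) (e : Fin n → C(Sphere d, ℂ)) :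
    Prop where
  mem : ∀ i, e i ∈ V
  inner_self : ∀ i, sphereL2Inner (e i) (e i) = 1
  sum_repr : ∀ f ∈ V, ∑ i, sphereL2Inner (e i) f • e i = f

theorem exists_isL2Basis {d : ℕ} (V : Submodule ℂ C(Sphere d, ℂ)) [FiniteDimensional ℂ V] :
    ∃ e : Fin (Module.finrank ℂ V) → C(Sphere d, ℂ), IsL2Basis V e := by
  -- The embedding into `L²` is injective because the surface measure is positive on nonempty open
  -- sets, so an orthonormal basis of the image pulls back to continuous functions.
  let J : C(Sphere d, ℂ) →ₗ[ℂ] Lp ℂ 2 (surfaceMeasure d) :=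
    (ContinuousMap.toLp 2 (surfaceMeasure d) ℂ).toLinearMap
  have hJ : Function.Injective J := ContinuousMap.toLp_injective (surfaceMeasure d)
  let E := Submodule.equivMapOfInjective J hJ V
  have : FiniteDimensional ℂ (V.map J) := inferInstance
  let b := (stdOrthonormalBasis ℂ (V.map J)).reindex (finCongr E.finrank_eq.symm)
  have hb : ∀ i, J (E.symm (b i)) = b i := fun i => by
    rw [← Submodule.coe_equivMapOfInjective_apply J hJ V, LinearEquiv.apply_symm_apply]
  have hin : ∀ i (f : V), sphereL2Inner (E.symm (b i) : C(Sphere d, ℂ)) f = inner ℂ (b i) (E f) := by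
    intro i f
    rw [Submodule.coe_inner, ← hb]
    exact (ContinuousMap.inner_toLp (surfaceMeasure d) _ _).symm
  refine ⟨fun i => E.symm (b i), fun i => (E.symm (b i)).2, fun i => ?_, fun f hf => ?_⟩
  · rw [hin, LinearEquiv.apply_symm_apply, b.inner_eq_one]
  · apply hJ
    rw [map_sum]
    simp only [map_smul, hb, hin _ ⟨f, hf⟩]
    have := congrArg Subtype.val (b.sum_repr' (E ⟨f, hf⟩))
    rw [← Submodule.coe_equivMapOfInjective_apply J hJ V ⟨f, hf⟩, ← this]
    simp

/-- The kernel of the orthogonal projection defined by an orthonormal family. -/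
noncomputable def familyKernel {d n : ℕ} (e : Fin n → C(Sphere d, ℂ)) (x y : Sphere d) : ℂ :=
  ∑ i, e i x * conj (e i y)

theorem continuous_familyKernel {d n : ℕ} (e : Fin n → C(Sphere d, ℂ)) :
    Continuous fun z : Sphere d × Sphere d => familyKernel e z.1 z.2 := by
  unfold familyKernel
  fun_prop

theorem conj_familyKernel {d n : ℕ} (e : Fin n → C(Sphere d, ℂ)) (x y : Sphere d) :
    conj (familyKernel e x y) = familyKernel e y x := by
  simp [familyKernel, map_sum, mul_comm]

namespace IsL2Basis

variable {d n : ℕ} {V : Submodule ℂ C(Sphere d, ℂ)} {e : Fin n → C(Sphere d, ℂ)}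

theorem integral_familyKernel_mul (he : IsL2Basis V e) {f : C(Sphere d, ℂ)} (hf : f ∈ V)
    (x : Sphere d) : ∫ y, familyKernel e x y * f y ∂surfaceMeasure d = f x := by
  have h : ∀ y, familyKernel e x y * f y = ∑ i, e i x * (f y * conj (e i y)) := fun y => by
    rw [familyKernel, Finset.sum_mul]
    exact Finset.sum_congr rfl fun i _ => by ring
  simp only [h]
  rw [integral_finsetSum _ fun i _ => integrable_of_continuous (by fun_prop)]
  conv_rhs => rw [← he.sum_repr f hf]
  simp [integral_const_mul, sphereL2Inner, mul_comm]

/-- Expanding `e'` in `e` on one side and `e` in `e'` on the other produces the same double sum.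
Applied to a basis and its image under an isometry, this gives the invariance of the kernel. -/
theorem familyKernel_eq {m : ℕ} {e' : Fin m → C(Sphere d, ℂ)} (he : IsL2Basis V e)
    (he' : IsL2Basis V e') (x y : Sphere d) : familyKernel e x y = familyKernel e' x y := by
  have h1 : ∀ i, e' i x = ∑ j, sphereL2Inner (e j) (e' i) * e j x := fun i => by
    conv_lhs => rw [← he.sum_repr _ (he'.mem i)]
    simp
  have h2 : ∀ j, conj (e j y) = ∑ i, sphereL2Inner (e j) (e' i) * conj (e' i y) := fun j => by
    conv_lhs => rw [← he'.sum_repr _ (he.mem j)]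
    simp [conj_sphereL2Inner]
  simp only [familyKernel, h1, h2, Finset.sum_mul, Finset.mul_sum]
  rw [Finset.sum_comm]
  exact Finset.sum_congr rfl fun i _ => Finset.sum_congr rfl fun j _ => by ring

theorem comp_sphereAction (he : IsL2Basis V e)
    (hV : ∀ (ρ : EuclideanSpace ℝ (Fin (d + 1)) ≃ₗᵢ[ℝ] EuclideanSpace ℝ (Fin (d + 1))),
      ∀ f ∈ V, f.comp (sphereAction ρ) ∈ V)
    (ρ : EuclideanSpace ℝ (Fin (d + 1)) ≃ₗᵢ[ℝ] EuclideanSpace ℝ (Fin (d + 1))) :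
    IsL2Basis V fun i => (e i).comp (sphereAction ρ) := by
  have hin : ∀ f g : C(Sphere d, ℂ), sphereL2Inner (f.comp (sphereAction ρ))
      (g.comp (sphereAction ρ)) = sphereL2Inner f g := by
    intro f g
    exact integral_comp_actOnSphere ρ (f := fun x => g x * conj (f x)) (by fun_prop)
  have hsymm : ∀ f : C(Sphere d, ℂ),
      (f.comp (sphereAction ρ.symm)).comp (sphereAction ρ) = f := by
    intro f
    refine ContinuousMap.ext fun ω : Sphere d => ?_
    change f (actOnSphere ρ.symm (actOnSphere ρ ω)) = f ω
    congr 1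
    ext1
    simp [actOnSphere]
  refine ⟨fun i => hV ρ _ (he.mem i), fun i => by rw [hin, he.inner_self], fun f hf => ?_⟩
  have h := congrArg (ContinuousMap.compRightAlgHom ℂ ℂ (sphereAction ρ))
    (he.sum_repr _ (hV ρ.symm f hf))
  rw [map_sum] at h
  simp only [map_smul, ContinuousMap.compRightAlgHom_apply, hsymm] at h
  conv_rhs => rw [← h]
  refine Finset.sum_congr rfl fun i _ => ?_
  rw [← hin (e i) (f.comp (sphereAction ρ.symm)), hsymm]

theorem isIsometryInvariant (he : IsL2Basis V e)
    (hV : ∀ (ρ : EuclideanSpace ℝ (Fin (d + 1)) ≃ₗᵢ[ℝ] EuclideanSpace ℝ (Fin (d + 1))),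
      ∀ f ∈ V, f.comp (sphereAction ρ) ∈ V) : IsIsometryInvariant (familyKernel e) :=
  fun ρ x y => (he.comp_sphereAction hV ρ).familyKernel_eq he x y

theorem familyKernel_right_mem (he : IsL2Basis V e) (x : Sphere d) :
    (∑ i, conj (e i x) • e i) ∈ V :=
  Submodule.sum_mem _ fun i _ => Submodule.smul_mem _ _ (he.mem i)

/-- The reproducing property, applied to the function `y ↦ K(y, x)` of `V` at the point `x`. -/
theorem integral_normSq_familyKernel (he : IsL2Basis V e) (x : Sphere d) :
    ((∫ y, ‖familyKernel e x y‖ ^ 2 ∂surfaceMeasure d : ℝ) : ℂ) = familyKernel e x x := by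
  have h : ∀ y, (∑ i, conj (e i x) • e i : C(Sphere d, ℂ)) y = familyKernel e y x := fun y => by
    simp [familyKernel, mul_comm]
  have := he.integral_familyKernel_mul (he.familyKernel_right_mem x) x
  rw [h] at this
  rw [← this, ← integral_complex_ofReal]
  refine integral_congr_ae (Filter.Eventually.of_forall fun y => ?_)
  simp only [h]
  rw [← conj_familyKernel e x y, Complex.mul_conj']
  push_cast
  rfl

theorem integral_familyKernel_diag (he : IsL2Basis V e) :
    ∫ x, familyKernel e x x ∂surfaceMeasure d = n := by
  simp only [familyKernel]
  rw [integral_finsetSum _ fun i _ => integrable_of_continuous (by fun_prop)]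
  have := he.inner_self
  unfold sphereL2Inner at this
  simp [this]

/-- The isometries act transitively, so the diagonal is constant; its integral is the trace `n` of
the projection. -/
theorem familyKernel_diag (he : IsL2Basis V e)
    (hV : ∀ (ρ : EuclideanSpace ℝ (Fin (d + 1)) ≃ₗᵢ[ℝ] EuclideanSpace ℝ (Fin (d + 1))),
      ∀ f ∈ V, f.comp (sphereAction ρ) ∈ V) (x : Sphere d) :
    familyKernel e x x = ((n / (surfaceMeasure d).real Set.univ : ℝ) : ℂ) := by
  have h := he.integral_familyKernel_diag
  have hpos := (surfaceMeasure_real_univ_pos d).ne'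
  simp only [(he.isIsometryInvariant hV).diag _ x, integral_const, Complex.real_smul] at h
  push_cast
  rw [← h, mul_div_cancel_left₀]
  exact_mod_cast hpos

end IsL2Basis


/-! ### Schur's test -/

/-- Schur's test for a kernel with symmetric modulus. -/
theorem eLpNorm_le_of_symmetric_kernel {X : Type*} [MeasurableSpace X] {μ : Measure X}
    [SFinite μ] {G : X → X → ℂ} (hG : Measurable (Function.uncurry G))
    (hsymm : ∀ x y, ‖G x y‖ₑ = ‖G y x‖ₑ) {C : ℝ≥0∞}
    (hC : ∀ x, ∫⁻ y, ‖G x y‖ₑ ∂μ ≤ C)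
    {p : ℝ≥0∞} (hp : 1 ≤ p) {f h : X → ℂ} (hf : Measurable f)
    (hh : ∀ x, ‖h x‖ₑ ≤ ∫⁻ y, ‖G x y‖ₑ * ‖f y‖ₑ ∂μ) :
    eLpNorm h p μ ≤ C * eLpNorm f p μ := by
  have hGx : ∀ x, Measurable fun y => ‖G x y‖ₑ := fun x =>
    (hG.comp (measurable_const.prodMk measurable_id)).enorm
  rcases eq_or_ne p ∞ with rfl | hptop
  · rw [eLpNorm_exponent_top, eLpNorm_exponent_top]
    refine eLpNormEssSup_le_of_ae_enorm_bound (Filter.Eventually.of_forall fun x => ?_)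
    calc ‖h x‖ₑ ≤ ∫⁻ y, ‖G x y‖ₑ * ‖f y‖ₑ ∂μ := hh x
      _ ≤ ∫⁻ y, ‖G x y‖ₑ * eLpNormEssSup f μ ∂μ := by
          refine lintegral_mono_ae ?_
          filter_upwards [enorm_ae_le_eLpNormEssSup f μ] with y hy
          gcongr
      _ = (∫⁻ y, ‖G x y‖ₑ ∂μ) * eLpNormEssSup f μ := lintegral_mul_const _ (hGx x)
      _ ≤ C * eLpNormEssSup f μ := by
          gcongr
          exact hC x
  have hp0 : p ≠ 0 := (zero_lt_one.trans_le hp).ne'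
  set r := p.toReal with hr
  have hr1 : 1 ≤ r := by
    rw [hr, ← ENNReal.toReal_one]
    exact ENNReal.toReal_mono hptop hp
  have hr0 : 0 < r := by linarith
  -- Hölder's inequality for the measure `|G(x, y)| dμ(y)`, whose mass is at most `C`.
  have hpoint : ∀ x, ‖h x‖ₑ ^ r ≤ C ^ (r - 1) * ∫⁻ y, ‖G x y‖ₑ * ‖f y‖ₑ ^ r ∂μ := by
    intro x
    set ν := μ.withDensity fun y => ‖G x y‖ₑ with hν
    have hmass : ν Set.univ ≤ C := by
      rw [hν, withDensity_apply _ MeasurableSet.univ, Measure.restrict_univ]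
      exact hC x
    have h1 : ‖h x‖ₑ ≤ eLpNorm f 1 ν := by
      rw [eLpNorm_one_eq_lintegral_enorm, hν, lintegral_withDensity_eq_lintegral_mul _ (hGx x)
        hf.enorm]
      exact hh x
    have h2 := eLpNorm_le_eLpNorm_mul_rpow_measure_univ (μ := ν) hp hf.aestronglyMeasurable
    have h3 : eLpNorm f p ν ^ r = ∫⁻ y, ‖G x y‖ₑ * ‖f y‖ₑ ^ r ∂μ := by
      rw [eLpNorm_eq_lintegral_rpow_enorm_toReal hp0 hptop, ← ENNReal.rpow_mul,
        one_div_mul_cancel hr0.ne', ENNReal.rpow_one, hν,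
        lintegral_withDensity_eq_lintegral_mul _ (hGx x) (hf.enorm.pow_const _)]
      rfl
    calc ‖h x‖ₑ ^ r ≤ (eLpNorm f p ν * ν Set.univ ^ (1 / (1 : ℝ≥0∞).toReal - 1 / r)) ^ r := by
          gcongr
          exact h1.trans h2
      _ = eLpNorm f p ν ^ r * ν Set.univ ^ (r - 1) := by
          rw [ENNReal.mul_rpow_of_nonneg _ _ hr0.le, ← ENNReal.rpow_mul]
          congr 2
          rw [ENNReal.toReal_one]
          field_simp
      _ ≤ (∫⁻ y, ‖G x y‖ₑ * ‖f y‖ₑ ^ r ∂μ) * C ^ (r - 1) := by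
          rw [h3]
          gcongr
      _ = _ := mul_comm _ _
  rw [eLpNorm_eq_lintegral_rpow_enorm_toReal hp0 hptop,
    eLpNorm_eq_lintegral_rpow_enorm_toReal hp0 hptop, ← hr]
  have hm : Measurable fun z : X × X => ‖G z.1 z.2‖ₑ * ‖f z.2‖ₑ ^ r :=
    hG.enorm.mul ((hf.comp measurable_snd).enorm.pow_const _)
  have hmain : ∫⁻ x, ‖h x‖ₑ ^ r ∂μ ≤ C ^ r * ∫⁻ y, ‖f y‖ₑ ^ r ∂μ := by
    calc ∫⁻ x, ‖h x‖ₑ ^ r ∂μ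
        ≤ ∫⁻ x, C ^ (r - 1) * ∫⁻ y, ‖G x y‖ₑ * ‖f y‖ₑ ^ r ∂μ ∂μ := lintegral_mono hpoint
      _ = C ^ (r - 1) * ∫⁻ x, ∫⁻ y, ‖G x y‖ₑ * ‖f y‖ₑ ^ r ∂μ ∂μ :=
          lintegral_const_mul _ hm.lintegral_prod_right'
      _ = C ^ (r - 1) * ∫⁻ y, ∫⁻ x, ‖G x y‖ₑ * ‖f y‖ₑ ^ r ∂μ ∂μ := by
          rw [lintegral_lintegral_swap hm.aemeasurable]
      _ ≤ C ^ (r - 1) * ∫⁻ y, C * ‖f y‖ₑ ^ r ∂μ := by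
          gcongr with y
          -- Symmetry turns the bound on integrals in the second variable into one in the first.
          simp only [hsymm _ y]
          rw [lintegral_mul_const _ (hGx y)]
          gcongr
          exact hC y
      _ = C ^ (r - 1) * C * ∫⁻ y, ‖f y‖ₑ ^ r ∂μ := by
          rw [lintegral_const_mul _ (hf.enorm.pow_const _), mul_assoc]
      _ = C ^ r * ∫⁻ y, ‖f y‖ₑ ^ r ∂μ := by
          congr 1
          conv_lhs => rw [← ENNReal.rpow_one C, ← ENNReal.rpow_mul]
          rw [one_mul, ← ENNReal.rpow_add_of_nonneg _ _ (by linarith) zero_le_one, sub_add_cancel]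
  calc (∫⁻ x, ‖h x‖ₑ ^ r ∂μ) ^ (1 / r) ≤ (C ^ r * ∫⁻ y, ‖f y‖ₑ ^ r ∂μ) ^ (1 / r) := by
        gcongr
    _ = C * (∫⁻ y, ‖f y‖ₑ ^ r ∂μ) ^ (1 / r) := by
        rw [ENNReal.mul_rpow_of_nonneg _ _ (by positivity), ← ENNReal.rpow_mul,
          mul_one_div_cancel hr0.ne', ENNReal.rpow_one]


/-! ### The kernel `K_{2L} K_L / K_L(N, N)`: reproduction and uniform `L¹` bound -/

/-- An orthonormal basis of `Π_n`. -/
noncomputable def harmonicBasis (d n : ℕ) :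
    Fin (Module.finrank ℂ (harmonicsUpTo d n)) → C(Sphere d, ℂ) :=
  (exists_isL2Basis (harmonicsUpTo d n)).choose

theorem harmonicBasis_isL2Basis (d n : ℕ) : IsL2Basis (harmonicsUpTo d n) (harmonicBasis d n) :=
  (exists_isL2Basis (harmonicsUpTo d n)).choose_spec

/-- The reproducing kernel of `Π_n`. -/
noncomputable def reproducingKernel (d n : ℕ) : Sphere d → Sphere d → ℂ :=
  familyKernel (harmonicBasis d n)

theorem reproducingKernel_isIsometryInvariant (d n : ℕ) :
    IsIsometryInvariant (reproducingKernel d n) :=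
  (harmonicBasis_isL2Basis d n).isIsometryInvariant
    fun ρ _ hf => comp_sphereAction_mem_harmonicsUpTo ρ hf

/-- The value of the reproducing kernel of `Π_n` on the diagonal. -/
noncomputable def kernelDiag (d n : ℕ) : ℝ :=
  Module.finrank ℂ (harmonicsUpTo d n) / (surfaceMeasure d).real Set.univ

theorem reproducingKernel_diag (d n : ℕ) (x : Sphere d) :
    reproducingKernel d n x x = kernelDiag d n :=
  (harmonicBasis_isL2Basis d n).familyKernel_diag
    (fun ρ _ hf => comp_sphereAction_mem_harmonicsUpTo ρ hf) x

theorem kernelDiag_pos (d n : ℕ) : 0 < kernelDiag d n := by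
  refine div_pos ?_ (surfaceMeasure_real_univ_pos d)
  have : Nontrivial (harmonicsUpTo d n) := by
    refine ⟨⟨1, one_mem_harmonicsUpTo d n⟩, 0, fun h => ?_⟩
    have := DFunLike.congr_fun (congrArg Subtype.val h) (northPole d)
    simp at this
  exact Nat.cast_pos.2 (Module.finrank_pos (R := ℂ) (M := harmonicsUpTo d n))

theorem kernelDiag_two_mul_le (d L : ℕ) :
    kernelDiag d (2 * L) ≤ 2 ^ (d + 1) * kernelDiag d L := by
  rw [kernelDiag, kernelDiag, ← mul_div_assoc]
  refine div_le_div_of_nonneg_right ?_ (surfaceMeasure_real_univ_pos d).le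
  exact_mod_cast finrank_harmonicsUpTo_two_mul_le d L

theorem integral_norm_sq_reproducingKernel (d n : ℕ) (x : Sphere d) :
    ∫ y, ‖reproducingKernel d n x y‖ ^ 2 ∂surfaceMeasure d = kernelDiag d n := by
  have h := (harmonicBasis_isL2Basis d n).integral_normSq_familyKernel x
  have h' := reproducingKernel_diag d n x
  rw [reproducingKernel] at h' ⊢
  rw [h'] at h
  exact_mod_cast h

/-- The de la Vallée Poussin type kernel `K_{2L} K_L / K_L(N, N)`. -/
noncomputable def reproducingProduct (d L : ℕ) (x y : Sphere d) : ℂ :=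
  (kernelDiag d L : ℂ)⁻¹ * (reproducingKernel d (2 * L) x y * reproducingKernel d L x y)

theorem continuous_reproducingProduct (d L : ℕ) :
    Continuous (Function.uncurry (reproducingProduct d L)) :=
  continuous_const.mul ((continuous_familyKernel _).mul (continuous_familyKernel _))

theorem continuous_reproducingProduct_right (d L : ℕ) (x : Sphere d) :
    Continuous (reproducingProduct d L x) :=
  (continuous_reproducingProduct d L).uncurry_left x

theorem continuous_reproducingProduct_left (d L : ℕ) (y : Sphere d) :
    Continuous fun x => reproducingProduct d L x y :=
  (continuous_reproducingProduct d L).uncurry_right y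

theorem reproducingProduct_isIsometryInvariant (d L : ℕ) :
    IsIsometryInvariant (reproducingProduct d L) := fun ρ x y => by
  simp only [reproducingProduct, reproducingKernel_isIsometryInvariant d _ ρ x y]

theorem integral_reproducingProduct_mul {d L : ℕ} {f : C(Sphere d, ℂ)}
    (hf : f ∈ harmonicsUpTo d L) (x : Sphere d) :
    ∫ y, reproducingProduct d L x y * f y ∂surfaceMeasure d = f x := by
  -- `F` is `K_L(·, x)`, visibly in `Π_L`; invariance makes the kernel symmetric, so it is also
  -- `K_L(x, ·)`.
  set F : C(Sphere d, ℂ) := ∑ i, conj (harmonicBasis d L i x) • harmonicBasis d L i with hF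
  have hFK : ∀ y, F y = reproducingKernel d L x y := fun y => by
    rw [(reproducingKernel_isIsometryInvariant d L).swap]
    simp [hF, reproducingKernel, familyKernel, mul_comm]
  have hmem : F * f ∈ harmonicsUpTo d (2 * L) := by
    rw [two_mul]
    exact mul_mem_harmonicsUpTo ((harmonicBasis_isL2Basis d L).familyKernel_right_mem x) hf
  have h := (harmonicBasis_isL2Basis d (2 * L)).integral_familyKernel_mul hmem x
  have h0 : (kernelDiag d L : ℂ) ≠ 0 := by exact_mod_cast (kernelDiag_pos d L).ne'
  calc ∫ y, reproducingProduct d L x y * f y ∂surfaceMeasure d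
      = ∫ y, (kernelDiag d L : ℂ)⁻¹ *
          (reproducingKernel d (2 * L) x y * (F * f) y) ∂surfaceMeasure d := by
        simp only [reproducingProduct, ContinuousMap.mul_apply, hFK, mul_assoc]
    _ = (kernelDiag d L : ℂ)⁻¹ * (F * f) x := by rw [integral_const_mul]; congr 1
    _ = f x := by
        rw [ContinuousMap.mul_apply, hFK, reproducingKernel_diag, inv_mul_cancel_left₀ h0]

theorem lintegral_enorm_reproducingProduct_le (d L : ℕ) (x : Sphere d) :
    ∫⁻ y, ‖reproducingProduct d L x y‖ₑ ∂surfaceMeasure d ≤ ENNReal.ofReal (2 ^ (d + 1)) := by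
  have hκ := kernelDiag_pos d L
  have hc : ∀ n, Continuous fun y => reproducingKernel d n x y := fun n =>
    (continuous_familyKernel (harmonicBasis d n)).comp (by fun_prop : Continuous fun y => (x, y))
  have hsq : ∀ n, Integrable (fun y => ‖reproducingKernel d n x y‖ ^ 2) (surfaceMeasure d) :=
    fun n => ((hc n).norm.pow 2).integrable_of_hasCompactSupport
      (HasCompactSupport.of_compactSpace _)
  have hint : Integrable (fun y => reproducingProduct d L x y) (surfaceMeasure d) :=
    integrable_of_continuous (continuous_reproducingProduct_right d L x)
  rw [← ofReal_integral_norm_eq_lintegral_enorm hint]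
  refine ENNReal.ofReal_le_ofReal ?_
  have hpt : ∀ y, ‖reproducingProduct d L x y‖ ≤ (kernelDiag d L)⁻¹ / 2 *
      (‖reproducingKernel d (2 * L) x y‖ ^ 2 + ‖reproducingKernel d L x y‖ ^ 2) := fun y => by
    rw [reproducingProduct, norm_mul, norm_mul, norm_inv, Complex.norm_real,
      Real.norm_of_nonneg hκ.le, div_mul_eq_mul_div, mul_div_assoc]
    refine mul_le_mul_of_nonneg_left ?_ (inv_nonneg.2 hκ.le)
    nlinarith [sq_nonneg (‖reproducingKernel d (2 * L) x y‖ - ‖reproducingKernel d L x y‖)]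
  calc ∫ y, ‖reproducingProduct d L x y‖ ∂surfaceMeasure d
      ≤ ∫ y, (kernelDiag d L)⁻¹ / 2 * (‖reproducingKernel d (2 * L) x y‖ ^ 2 +
          ‖reproducingKernel d L x y‖ ^ 2) ∂surfaceMeasure d :=
        integral_mono hint.norm (((hsq _).add (hsq _)).const_mul _) hpt
    _ = (kernelDiag d L)⁻¹ / 2 * (kernelDiag d (2 * L) + kernelDiag d L) := by
        rw [integral_const_mul, integral_add (hsq _) (hsq _), integral_norm_sq_reproducingKernel,
          integral_norm_sq_reproducingKernel]
    -- Doubling bounds the first term; the second is enlarged by the same factor to give a clean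
    -- constant.
    _ ≤ (kernelDiag d L)⁻¹ / 2 * (2 ^ (d + 1) * kernelDiag d L + 2 ^ (d + 1) * kernelDiag d L) := by
        refine mul_le_mul_of_nonneg_left ?_ (by positivity)
        have h1 : (1 : ℝ) ≤ 2 ^ (d + 1) := one_le_pow₀ (by norm_num)
        nlinarith [kernelDiag_two_mul_le d L]
    _ = 2 ^ (d + 1) := by
        field_simp
        ring

/-! ### The operator on functions, on `L^p` and on spherical polynomials -/

/-- The integral operator with the kernel `reproducingProduct d L`, as a finite sum. -/
noncomputable def reproducingOperator (d L : ℕ) (f : Sphere d → ℂ) : C(Sphere d, ℂ) :=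
  ∑ i, ∑ j, ((kernelDiag d L : ℂ)⁻¹ *
      ∫ y, (star (harmonicBasis d (2 * L) i * harmonicBasis d L j) : C(Sphere d, ℂ)) y * f y
        ∂surfaceMeasure d) •
    (harmonicBasis d (2 * L) i * harmonicBasis d L j)

theorem reproducingOperator_mem (d L : ℕ) (f : Sphere d → ℂ) :
    reproducingOperator d L f ∈ harmonicsUpTo d (3 * L) := by
  refine Submodule.sum_mem _ fun i _ => Submodule.sum_mem _ fun j _ => Submodule.smul_mem _ _ ?_
  rw [show 3 * L = 2 * L + L by ring]
  exact mul_mem_harmonicsUpTo ((harmonicBasis_isL2Basis d _).mem i)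
    ((harmonicBasis_isL2Basis d _).mem j)

theorem integrable_continuousMap_mul {d : ℕ} (F : C(Sphere d, ℂ)) {f : Sphere d → ℂ}
    (hf : Integrable f (surfaceMeasure d)) :
    Integrable (fun y => F y * f y) (surfaceMeasure d) :=
  hf.bdd_mul (c := ‖F‖) F.continuous.aestronglyMeasurable
    (Filter.Eventually.of_forall F.norm_coe_le_norm)

theorem integrable_reproducingProduct_mul {d : ℕ} (L : ℕ) {f : Sphere d → ℂ}
    (hf : Integrable f (surfaceMeasure d)) (x : Sphere d) :
    Integrable (fun y => reproducingProduct d L x y * f y) (surfaceMeasure d) :=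
  integrable_continuousMap_mul
    ⟨reproducingProduct d L x, continuous_reproducingProduct_right d L x⟩ hf

theorem reproducingOperator_apply {d : ℕ} (L : ℕ) {f : Sphere d → ℂ}
    (hf : Integrable f (surfaceMeasure d)) (x : Sphere d) :
    reproducingOperator d L f x = ∫ y, reproducingProduct d L x y * f y ∂surfaceMeasure d := by
  have h : ∀ y, reproducingProduct d L x y * f y = ∑ i, ∑ j,
      ((kernelDiag d L : ℂ)⁻¹ * (harmonicBasis d (2 * L) i * harmonicBasis d L j) x) *
      ((star (harmonicBasis d (2 * L) i * harmonicBasis d L j) : C(Sphere d, ℂ)) y * f y) := by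
    intro y
    rw [reproducingProduct, reproducingKernel, reproducingKernel, familyKernel, familyKernel,
      Finset.sum_mul_sum]
    simp only [Finset.mul_sum, Finset.sum_mul]
    refine Finset.sum_congr rfl fun i _ => Finset.sum_congr rfl fun j _ => ?_
    simp only [ContinuousMap.star_apply, ContinuousMap.mul_apply, star_mul]
    simp only [← starRingEnd_apply (R := ℂ)]
    ring
  simp only [h]
  have hi : ∀ i j, Integrable (fun y =>
      ((kernelDiag d L : ℂ)⁻¹ * (harmonicBasis d (2 * L) i * harmonicBasis d L j) x) *
      ((star (harmonicBasis d (2 * L) i * harmonicBasis d L j) : C(Sphere d, ℂ)) y * f y))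
      (surfaceMeasure d) := fun i j => (integrable_continuousMap_mul _ hf).const_mul _
  rw [integral_finsetSum Finset.univ fun i _ =>
    integrable_finsetSum Finset.univ fun j _ => hi i j]
  simp only [reproducingOperator, ContinuousMap.sum_apply]
  refine Finset.sum_congr rfl fun i _ => ?_
  rw [integral_finsetSum Finset.univ fun j _ => hi i j]
  refine Finset.sum_congr rfl fun j _ => ?_
  rw [integral_const_mul, ContinuousMap.smul_apply, smul_eq_mul]
  ring

/-- Lets the operator be computed on any representative of an `L^p` class. -/
theorem reproducingOperator_congr {d : ℕ} (L : ℕ) {f g : Sphere d → ℂ}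
    (h : f =ᵐ[surfaceMeasure d] g) : reproducingOperator d L f = reproducingOperator d L g := by
  unfold reproducingOperator
  refine Finset.sum_congr rfl fun i _ => Finset.sum_congr rfl fun j _ => ?_
  congr 2
  refine integral_congr_ae ?_
  filter_upwards [h] with y hy
  rw [hy]

theorem reproducingOperator_add {d : ℕ} (L : ℕ) {f g : Sphere d → ℂ}
    (hf : Integrable f (surfaceMeasure d)) (hg : Integrable g (surfaceMeasure d)) :
    reproducingOperator d L (f + g) = reproducingOperator d L f + reproducingOperator d L g := by
  ext x
  rw [ContinuousMap.add_apply, reproducingOperator_apply L hf, reproducingOperator_apply L hg,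
    reproducingOperator_apply L (hf.add hg), ← integral_add
      (integrable_reproducingProduct_mul L hf x) (integrable_reproducingProduct_mul L hg x)]
  simp [mul_add]

theorem reproducingOperator_smul {d : ℕ} (L : ℕ) (c : ℂ) {f : Sphere d → ℂ}
    (hf : Integrable f (surfaceMeasure d)) :
    reproducingOperator d L (c • f) = c • reproducingOperator d L f := by
  ext x
  rw [ContinuousMap.smul_apply, reproducingOperator_apply L hf,
    reproducingOperator_apply L (hf.smul c), smul_eq_mul, ← integral_const_mul]
  refine integral_congr_ae (Filter.Eventually.of_forall fun y => ?_)
  simp only [Pi.smul_apply, smul_eq_mul]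
  ring

theorem reproducingOperator_eq_self {d L : ℕ} {f : C(Sphere d, ℂ)} (hf : f ∈ harmonicsUpTo d L) :
    reproducingOperator d L f = f := by
  ext x
  rw [reproducingOperator_apply L (integrable_of_continuous f.continuous),
    integral_reproducingProduct_mul hf]

theorem eLpNorm_reproducingOperator_le {d : ℕ} (L : ℕ) {p : ℝ≥0∞} (hp : 1 ≤ p)
    {f : Sphere d → ℂ} (hf : Measurable f) (hfi : Integrable f (surfaceMeasure d)) :
    eLpNorm (reproducingOperator d L f) p (surfaceMeasure d) ≤
      ENNReal.ofReal (2 ^ (d + 1)) * eLpNorm f p (surfaceMeasure d) := by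
  refine eLpNorm_le_of_symmetric_kernel (continuous_reproducingProduct d L).measurable
    (fun x y => by rw [(reproducingProduct_isIsometryInvariant d L).swap])
    (lintegral_enorm_reproducingProduct_le d L) hp hf fun x => ?_
  rw [reproducingOperator_apply L hfi]
  refine (enorm_integral_le_lintegral_enorm _).trans_eq ?_
  simp only [enorm_mul]

/-- The reproducing operator on `L^p`. -/
noncomputable def reproducingOperatorLp (d L : ℕ) (p : ℝ≥0∞) [hp : Fact (1 ≤ p)] :
    Lp ℂ p (surfaceMeasure d) →ₗ[ℂ] Lp ℂ p (surfaceMeasure d) where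
  toFun f := ContinuousMap.toLp p (surfaceMeasure d) ℂ (reproducingOperator d L f)
  map_add' f g := by
    rw [reproducingOperator_congr L (Lp.coeFn_add f g), reproducingOperator_add L
      ((Lp.memLp f).integrable hp.out) ((Lp.memLp g).integrable hp.out), map_add]
  map_smul' c f := by
    rw [reproducingOperator_congr L (Lp.coeFn_smul c f), reproducingOperator_smul L c
      ((Lp.memLp f).integrable hp.out), map_smul, RingHom.id_apply]

theorem norm_reproducingOperatorLp_le (d L : ℕ) (p : ℝ≥0∞) [hp : Fact (1 ≤ p)]
    (f : Lp ℂ p (surfaceMeasure d)) : ‖reproducingOperatorLp d L p f‖ ≤ 2 ^ (d + 1) * ‖f‖ := by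
  have h := eLpNorm_reproducingOperator_le L hp.out (Lp.stronglyMeasurable f).measurable
    ((Lp.memLp f).integrable hp.out)
  change ‖ContinuousMap.toLp p (surfaceMeasure d) ℂ (reproducingOperator d L f)‖ ≤ _
  rw [Lp.norm_def, Lp.norm_def, eLpNorm_congr_ae (ContinuousMap.coeFn_toLp (surfaceMeasure d) _)]
  refine (ENNReal.toReal_mono (ENNReal.mul_ne_top ENNReal.ofReal_ne_top
    (Lp.eLpNorm_ne_top f)) h).trans_eq ?_
  rw [ENNReal.toReal_mul, ENNReal.toReal_ofReal (by positivity)]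

/-- The reproducing operator on spherical polynomials. -/
noncomputable def reproducingMultiplier (d L : ℕ) : spherePolynomials d →ₗ[ℂ] C(Sphere d, ℂ) where
  toFun f := reproducingOperator d L (f : C(Sphere d, ℂ))
  map_add' f g := reproducingOperator_add L (integrable_of_continuous f.1.continuous)
    (integrable_of_continuous g.1.continuous)
  map_smul' c f := reproducingOperator_smul L c (integrable_of_continuous f.1.continuous)

/-- Change of variables by the isometry, which preserves both the measure and the kernel. -/
theorem reproducingMultiplier_isZonalMultiplier (d L : ℕ) :
    IsZonalMultiplier (reproducingMultiplier d L) := by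
  intro ρ _ f h hfh ω
  change reproducingOperator d L (h : C(Sphere d, ℂ)) ω =
    reproducingOperator d L (f : C(Sphere d, ℂ)) (actOnSphere ρ ω)
  rw [reproducingOperator_apply L (integrable_of_continuous h.1.continuous),
    reproducingOperator_apply L (integrable_of_continuous f.1.continuous),
    ← integral_comp_actOnSphere ρ
      (f := fun y => reproducingProduct d L (actOnSphere ρ ω) y * (f : C(Sphere d, ℂ)) y)
      ((continuous_reproducingProduct_right d L _).mul f.1.continuous)]
  refine integral_congr_ae (Filter.Eventually.of_forall fun y => ?_)
  beta_reduce
  rw [reproducingProduct_isIsometryInvariant d L ρ, hfh]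

theorem convIntegrand_reproducingProduct {d : ℕ} (L : ℕ) (f : Sphere d → ℂ) (ω : Sphere d) :
    convIntegrand (fun ω => reproducingProduct d L ω (northPole d)) f ω =
      fun x => reproducingProduct d L ω x * f x := by
  funext x
  rw [convIntegrand, (reproducingProduct_isIsometryInvariant d L).profile_sphereInner]

end SphereMultiplier

open SphereMultiplier
theorem mainTheorem9 (d : ℕ) (hd : 1 ≤ d) :
    ∃ C : ℝ, ∀ L : ℕ,
      ∃ (g : Sphere d → ℂ) (M : spherePolynomials d →ₗ[ℂ] C(Sphere d, ℂ)),
        Integrable g (surfaceMeasure d) ∧ IsZonal g ∧ HasProfile g ∧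
        IsZonalMultiplier M ∧
        (∀ (f : spherePolynomials d) (ω : Sphere d),
          Integrable (convIntegrand g (f : C(Sphere d, ℂ)) ω) (surfaceMeasure d) ∧
            M f ω = zonalConv g (f : C(Sphere d, ℂ)) ω) ∧
        ∀ (p : ℝ≥0∞) [Fact (1 ≤ p)],
          ∃ T : Lp ℂ p (surfaceMeasure d) →L[ℂ] Lp ℂ p (surfaceMeasure d),
            (∀ f : Lp ℂ p (surfaceMeasure d), ∀ᵐ ω ∂(surfaceMeasure d),
              Integrable (convIntegrand g f ω) (surfaceMeasure d) ∧
                T f ω = zonalConv g f ω) ∧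
            ‖T‖ ≤ C ∧
            (∀ f : Lp ℂ p (surfaceMeasure d), ∃ Q ∈ harmonicsUpTo d (3 * L),
              T f = ContinuousMap.toLp p (surfaceMeasure d) ℂ Q) ∧
            (∀ Q ∈ harmonicsUpTo d L,
              T (ContinuousMap.toLp p (surfaceMeasure d) ℂ Q) =
                ContinuousMap.toLp p (surfaceMeasure d) ℂ Q) := by
  have hconv : ∀ (L : ℕ) {f : Sphere d → ℂ}, Integrable f (surfaceMeasure d) → ∀ ω,
      Integrable (convIntegrand (fun ω => reproducingProduct d L ω (northPole d)) f ω)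
        (surfaceMeasure d) ∧ reproducingOperator d L f ω =
          zonalConv (fun ω => reproducingProduct d L ω (northPole d)) f ω := by
    intro L f hf ω
    rw [zonalConv, convIntegrand_reproducingProduct]
    exact ⟨integrable_reproducingProduct_mul L hf ω, reproducingOperator_apply L hf ω⟩
  have hG := reproducingProduct_isIsometryInvariant d
  -- The constant is the doubling factor, and `g` is the kernel with its second argument at the
  -- pole.
  refine ⟨2 ^ (d + 1), fun L => ⟨fun ω => reproducingProduct d L ω (northPole d),
    reproducingMultiplier d L, integrable_of_continuous
      (continuous_reproducingProduct_left d L _), (hG L).isZonal, (hG L).hasProfile,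
    reproducingMultiplier_isZonalMultiplier d L,
    fun f => hconv L (integrable_of_continuous f.1.continuous), fun p hp => ?_⟩⟩
  refine ⟨(reproducingOperatorLp d L p).mkContinuous _ (norm_reproducingOperatorLp_le d L p),
    fun f => ?_, LinearMap.mkContinuous_norm_le _ (by positivity) _,
    fun f => ⟨_, reproducingOperator_mem d L f, rfl⟩, fun Q hQ => ?_⟩
  · filter_upwards [ContinuousMap.coeFn_toLp (p := p) (𝕜 := ℂ) (surfaceMeasure d)
      (reproducingOperator d L f)] with ω hω
    have h := hconv L ((Lp.memLp f).integrable hp.out) ω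
    exact ⟨h.1, hω.trans h.2⟩
  · change ContinuousMap.toLp p (surfaceMeasure d) ℂ (reproducingOperator d L _) = _
    rw [reproducingOperator_congr L (ContinuousMap.coeFn_toLp (surfaceMeasure d) Q),
      reproducingOperator_eq_self hQ]
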